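/- **Setting.** Let $\mathcal X\subset\mathbb R^{d}$ and $\Xi\subset\mathbb R^{e}$ be finite sets and $\mathcal A$ a finite set of actions. Let $P^0_x$ be a probability distribution on $\mathcal X$, let $\pi_0(\cdot|x)$ and $\pi(\cdot|x)$ (the behavior policy and the evaluation policy) be probability distributions on $\mathcal A$ for each $x\in\mathcal X$, let $P^0_{\Xi_{x,a}}$ be a probability distribution on $\Xi$ and $y_{x,a}:\Xi\to[0,Y_{\max}]$ a cost function for each $(x,a)\in\mathcal X\times\mathcal A$. Assume $\pi_0(a|x)\ge\mu_{\pi_0}>0$ and $P^0_x(x)\ge\mu_{x_0}>0$ for all $(x,a)$. The data $(X_i,A_i,\xi_i)$, $i=1,\dots,n$, are i.i.d. with $X_i\sim P^0_x$, $A_i\sim\pi_0(\cdot|X_i)$, $\xi_i\sim P^0_{\Xi_{X_i,A_i}}$ (the observed cost is $Y_i=y_{X_i,A_i}(\xi_i)$). For probability distributions $P,Q$ on a finite set $S$ of points of a Euclidean space let $D(P,Q)$ be the minimum of $\mathbb E_{(s,t)\sim\sigma}\|s-t\|^2$ over all couplings $\sigma$ of $P$ and $Q$, and let $\mathcal U(\epsilon;P^0)$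 be the set of probability distributions $P$ on $S$ with $D(P^0,P)\le\epsilon$. For radii $\epsilon_x,\epsilon_c>0$ the distributionally robust policy value is $$V(\pi)=\sup_{P\in\mathcal U(\epsilon_x;P^0_x)}\mathbb E_{x\sim P}\,\mathbb E_{a\sim\pi(\cdot|x)}\Big[\sup_{Q\in\mathcal U(\epsilon_c;P^0_{\Xi_{x,a}})}\mathbb E_{\xi\sim Q}[y_{x,a}(\xi)]\Big].$$ Let $\hat P^0_x$ be the empirical distribution of $X_1,\dots,X_n$ and $\hat P^0_{\Xi_{x,a}}$ the empirical distribution of those $\xi_i$ with $(X_i,A_i)=(x,a)$ (the zero measure if there are none). The empirical policy value is $$\hat V(\pi)=\inf_{\lambda\ge0}\Big\{\epsilon_x\lambda+\mathbb E_{x\sim\hat P^0_x}\Big[\sup_{\zeta\in\mathcal X}\big(\mathbb E_{a\sim\pi(\cdot|\zeta)}[\hat m(\zeta,a)]-\lambda\|x-\zeta\|^2\big)\Big]\Big\},$$ $$\hat m(x,a)=\inf_{\lambda\ge0}\Big\{\epsilon_c\lambda+\mathbb E_{\xi\sim\hat P^0_{\Xi_{x,a}}}\Big[\sup_{\zeta\in\Xi}\big(y_{x,a}(\zeta)-\lambda\|\xi-\zeta\|^2\big)\Big]\Big\}.$$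 **Theorem.** Let $\delta\in(0,1)$ and $n\ge 2\log(4|\mathcal X||\mathcal A|/\delta)/(\mu_{\pi_0}\mu_{x_0})^2$. Then, with probability at least $1-\delta$, $$|\hat V(\pi)-V(\pi)|\le Y_{\max}\Bigg(\sqrt{\frac{2\log(2/\delta)}{n}}+\sqrt{\frac{|\mathcal X|}{n}}+\sqrt{\frac{4\log(4|\mathcal X||\mathcal A|/\delta)}{n\mu_{\pi_0}\mu_{x_0}}}+\sqrt{\frac{2|\Xi|}{n\mu_{\pi_0}\mu_{x_0}}}\Bigg).$$ Moreover, the right-hand side is at most $$C\sqrt{\frac{\log(|\mathcal X||\mathcal A|/\delta)}{n}}+C\sqrt{\frac{|\mathcal X|+|\Xi|}{n}}$$ for a constant $C\ge 0$ that depends only on $Y_{\max}$, $\mu_{\pi_0}$ and $\mu_{x_0}$; in particular neither bound depends on the radii $\epsilon_x,\epsilon_c$. -/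

import Mathlib

open MeasureTheory ProbabilityTheory

noncomputable section

/-- Expectation `E_{s ∼ P}[f s]` for a probability vector `P` on a finite type. -/
def expect {S : Type*} [Fintype S] (P f : S → ℝ) : ℝ := ∑ s, P s * f s

/-- Couplings of `P` and `Q`: probability vectors on `S × S` with first marginal `P`
and second marginal `Q`. -/
def couplings {S : Type*} [Fintype S] (P Q : S → ℝ) : Set (S × S → ℝ) :=
  {σ | σ ∈ stdSimplex ℝ (S × S) ∧ (∀ s, ∑ t, σ (s, t) = P s) ∧ (∀ t, ∑ s, σ (s, t) = Q t)}

/-- Wasserstein (optimal transport) distance, with transport cost `c(s, t) = ‖s - t‖²`, between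
two probability vectors on a finite set `S` of points of Euclidean space. -/
def wassersteinDist {d : ℕ} {S : Finset (EuclideanSpace ℝ (Fin d))} (P Q : S → ℝ) : ℝ :=
  sInf ((fun σ : S × S → ℝ => expect σ (fun z => ‖(z.1 : EuclideanSpace ℝ (Fin d)) - z.2‖ ^ 2)) ''
    couplings P Q)

/-- The uncertainty set `U(ε; P₀)`: all probability vectors on `S` within Wasserstein distance `ε`
of `P₀`. -/
def uncertaintySet {d : ℕ} {S : Finset (EuclideanSpace ℝ (Fin d))} (ε : ℝ) (P₀ : S → ℝ) :
    Set (S → ℝ) :=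
  {P | P ∈ stdSimplex ℝ S ∧ wassersteinDist P₀ P ≤ ε}

/-- The primal problem `sup_{P ∈ U(ε; P₀)} E_P[f]`. -/
def primalDRO {d : ℕ} {S : Finset (EuclideanSpace ℝ (Fin d))} (ε : ℝ) (P₀ f : S → ℝ) : ℝ :=
  sSup ((fun P : S → ℝ => expect P f) '' uncertaintySet ε P₀)

/-- The dual problem `inf_{lam ≥ 0} {ε lam + E_{s ∼ P₀}[sup_{ζ ∈ S} (f ζ - lam ‖s - ζ‖²)]}`. -/
def dualDRO {d : ℕ} {S : Finset (EuclideanSpace ℝ (Fin d))} (ε : ℝ) (P₀ f : S → ℝ) : ℝ :=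
  sInf ((fun lam : ℝ => ε * lam + expect P₀ (fun s =>
    ⨆ ζ : S, (f ζ - lam * ‖(s : EuclideanSpace ℝ (Fin d)) - ζ‖ ^ 2))) '' Set.Ici 0)

/-- The distributionally robust policy value `V(π)`:
`sup_{P ∈ U(εx; P₀)} E_{x ∼ P} E_{a ∼ π(·|x)} sup_{Q ∈ U(εc; Q₀ x a)} E_{ξ ∼ Q}[y_{x,a}(ξ)]`. -/
def policyValue {d e : ℕ} {𝒳 : Finset (EuclideanSpace ℝ (Fin d))}
    {Ξ : Finset (EuclideanSpace ℝ (Fin e))} {A : Type*} [Fintype A] (εx εc : ℝ)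
    (P₀ : 𝒳 → ℝ) (Q₀ : 𝒳 → A → Ξ → ℝ) (y : 𝒳 → A → Ξ → ℝ) (π : 𝒳 → A → ℝ) : ℝ :=
  primalDRO εx P₀ (fun x => expect (π x) (fun a => primalDRO εc (Q₀ x a) (y x a)))

open Classical in
/-- Empirical context distribution of a dataset of triples (context, action, `ξ`). -/
def empContext {X A Z : Type*} {n : ℕ} (D : Fin n → X × A × Z) (x : X) : ℝ :=
  ((Finset.univ.filter (fun i => (D i).1 = x)).card : ℝ) / n

open Classical in
/-- Empirical distribution of `ξ` among the samples with context `x` and action `a`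
(identically `0` if there is no such sample). -/
def empOutcome {X A Z : Type*} {n : ℕ} (D : Fin n → X × A × Z) (x : X) (a : A) (z : Z) : ℝ :=
  ((Finset.univ.filter (fun i => D i = (x, a, z))).card : ℝ) /
    ((Finset.univ.filter (fun i => (D i).1 = x ∧ (D i).2.1 = a)).card : ℝ)

/-- The empirical policy value: the two-level dual problem at the empirical distributions. -/
def empPolicyValue {d e : ℕ} {𝒳 : Finset (EuclideanSpace ℝ (Fin d))}
    {Ξ : Finset (EuclideanSpace ℝ (Fin e))} {A : Type*} [Fintype A] (εx εc : ℝ) {n : ℕ}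
    (D : Fin n → 𝒳 × A × Ξ) (y : 𝒳 → A → Ξ → ℝ) (π : 𝒳 → A → ℝ) : ℝ :=
  dualDRO εx (empContext D)
    (fun x => expect (π x) (fun a => dualDRO εc (empOutcome D x a) (y x a)))

/-- `D` is a logged dataset: the triples `(Xᵢ, Aᵢ, ξᵢ)` are independent, `Xᵢ ∼ P₀`,
`Aᵢ ∼ π₀(· | Xᵢ)` and `ξᵢ ∼ Q₀ Xᵢ Aᵢ`. -/
def IsLoggedData {X A Z Ω : Type*} [MeasurableSpace X] [MeasurableSpace A] [MeasurableSpace Z]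
    [MeasurableSpace Ω] (P₀ : X → ℝ) (π₀ : X → A → ℝ) (Q₀ : X → A → Z → ℝ)
    (μ : Measure Ω) {n : ℕ} (D : Fin n → Ω → X × A × Z) : Prop :=
  (∀ i, Measurable (D i)) ∧ iIndepFun D μ ∧
    ∀ i x a z, μ.real {ω | D i ω = (x, a, z)} = P₀ x * π₀ x a * Q₀ x a z

/-- The right-hand side of the finite-sample bound; `cX`, `cA`, `cZ` are the cardinalities of the
context set, the action set and the set `Ξ`. -/
def opeBound (Ymax μπ μx δ : ℝ) (n cX cA cZ : ℕ) : ℝ :=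
  Ymax * (√(2 * Real.log (2 / δ) / n) + √((cX : ℝ) / n) +
    √(4 * Real.log (4 * cX * cA / δ) / (n * (μπ * μx))) + √(2 * cZ / (n * (μπ * μx))))

end

/-! Strong duality turns the policy value into the same two-level dual expression as the empirical
value, evaluated at the true distributions. Only the stability of a dual value is then needed. For a
cost with values in `[0, M]` the penalized supremum also lies in `[0, M]`, whatever the multiplier.
Hence the dual value moves by at most `M` times the total variation between reference laws, and by
at most the sup-norm change of the cost; the radii never enter
(`abs_dualDRO_sub_le_of_forall_sum_le`, `abs_dualDRO_sub_le_of_abs_sub_le`).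

Total variation is a maximum over events, so Hoeffding's bound for each event and a union over the
`2 ^ |S|` events control it; this produces the terms in `|𝒳|` and `|Ξ|`. The outcome law of a cell
`(x, a)` rests on a random number of samples. A count bound makes that number at least half of `n *
(μπ * μx)`, and an exponential weight supported on the cell replaces conditioning. -/

/-! ### Expectations under probability vectors -/

theorem expect_mono {S : Type*} [Fintype S] {P f g : S → ℝ} (hP : ∀ s, 0 ≤ P s)
    (h : ∀ s, f s ≤ g s) : expect P f ≤ expect P g :=
  Finset.sum_le_sum fun s _ => mul_le_mul_of_nonneg_left (h s) (hP s)

theorem expect_const {S : Type*} [Fintype S] {P : S → ℝ} (hP : P ∈ stdSimplex ℝ S) (c : ℝ) :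
    expect P (fun _ => c) = c := by
  simp [expect, ← Finset.sum_mul, hP.2]

theorem expect_sub {S : Type*} [Fintype S] (P f g : S → ℝ) :
    expect P (fun s => f s - g s) = expect P f - expect P g := by
  simp [expect, mul_sub]

theorem expect_nonneg {S : Type*} [Fintype S] {P f : S → ℝ} (hP : P ∈ stdSimplex ℝ S)
    (h : ∀ s, 0 ≤ f s) : 0 ≤ expect P f :=
  Finset.sum_nonneg fun s _ => mul_nonneg (hP.1 s) (h s)

theorem expect_le {S : Type*} [Fintype S] {P f : S → ℝ} {M : ℝ} (hP : P ∈ stdSimplex ℝ S)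
    (h : ∀ s, f s ≤ M) : expect P f ≤ M :=
  (expect_mono hP.1 h).trans_eq (expect_const hP M)

theorem abs_expect_sub_le {S : Type*} [Fintype S] {P f g : S → ℝ} {r : ℝ}
    (hP : P ∈ stdSimplex ℝ S) (h : ∀ s, |f s - g s| ≤ r) : |expect P f - expect P g| ≤ r := by
  rw [← expect_sub, abs_le]
  constructor
  · rw [← expect_const hP (-r)]
    exact expect_mono hP.1 fun s => (abs_le.1 (h s)).1
  · exact expect_le hP fun s => (abs_le.1 (h s)).2

theorem nonempty_of_mem_stdSimplex {S : Type*} [Fintype S] {P : S → ℝ}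
    (hP : P ∈ stdSimplex ℝ S) : Nonempty S := by
  by_contra h
  rw [not_nonempty_iff] at h
  simpa using hP.2

/-- If two probability vectors differ by at most `t` on every event, then the expectations of a
function with values in `[0, M]` differ by at most `M * t`. -/
theorem abs_expect_sub_le_of_forall_sum_le {S : Type*} [Fintype S] {P P' g : S → ℝ} {M t : ℝ}
    (hP : P ∈ stdSimplex ℝ S) (hP' : P' ∈ stdSimplex ℝ S) (hg : ∀ s, 0 ≤ g s ∧ g s ≤ M)
    (h : ∀ U : Finset S, ∑ s ∈ U, P' s - ∑ s ∈ U, P s ≤ t) :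
    |expect P' g - expect P g| ≤ M * t := by
  classical
  have key : ∀ k : S → ℝ, (∀ s, 0 ≤ k s ∧ k s ≤ M) → expect P' k - expect P k ≤ M * t := by
    intro k hk
    obtain ⟨s₀⟩ := nonempty_of_mem_stdSimplex hP
    have hM : 0 ≤ M := (hk s₀).1.trans (hk s₀).2
    -- The event carrying the positive part of `P' - P`; outside it the terms are nonpositive.
    let U : Finset S := Finset.univ.filter fun s => P s ≤ P' s
    calc expect P' k - expect P k = ∑ s, (P' s - P s) * k s := by simp [expect, sub_mul]
      _ ≤ ∑ s, if P s ≤ P' s then M * (P' s - P s) else 0 := by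
        refine Finset.sum_le_sum fun s _ => ?_
        split_ifs with hs
        · nlinarith [(hk s).2]
        · nlinarith [(hk s).1]
      _ = M * (∑ s ∈ U, P' s - ∑ s ∈ U, P s) := by
        rw [← Finset.sum_filter, ← Finset.mul_sum, Finset.sum_sub_distrib]
      _ ≤ M * t := mul_le_mul_of_nonneg_left (h U) hM
  have h1 := key g hg
  -- Reflecting `g` to `M - g` gives the other sign, since both total masses are one.
  have h2 := key (fun s => M - g s) fun s => ⟨by linarith [(hg s).2], by linarith [(hg s).1]⟩
  rw [expect_sub, expect_sub, expect_const hP, expect_const hP'] at h2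
  rw [abs_le]
  constructor <;> linarith

/-! ### Stability of the dual value and strong duality -/

section Duality

variable {d : ℕ} {S : Finset (EuclideanSpace ℝ (Fin d))}

theorem le_iSup_penalized (f : S → ℝ) (lam : ℝ) (s ζ : S) :
    f ζ - lam * ‖(s : EuclideanSpace ℝ (Fin d)) - ζ‖ ^ 2 ≤
      ⨆ ζ : S, (f ζ - lam * ‖(s : EuclideanSpace ℝ (Fin d)) - ζ‖ ^ 2) :=
  le_ciSup (f := fun ζ : S => f ζ - lam * ‖(s : EuclideanSpace ℝ (Fin d)) - ζ‖ ^ 2)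
    (Set.finite_range _).bddAbove ζ

theorem self_le_iSup_penalized (f : S → ℝ) (lam : ℝ) (s : S) :
    f s ≤ ⨆ ζ : S, (f ζ - lam * ‖(s : EuclideanSpace ℝ (Fin d)) - ζ‖ ^ 2) := by
  simpa using le_iSup_penalized f lam s s

/-- The choice `ζ = s` costs nothing, and the penalty only lowers `f`. Uniformity in `lam` is what
frees the final bound from the radii. -/
theorem iSup_penalized_mem {f : S → ℝ} {M lam : ℝ} (hf : ∀ s, 0 ≤ f s ∧ f s ≤ M)
    (hlam : 0 ≤ lam) (s : S) :
    0 ≤ (⨆ ζ : S, (f ζ - lam * ‖(s : EuclideanSpace ℝ (Fin d)) - ζ‖ ^ 2)) ∧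
      (⨆ ζ : S, (f ζ - lam * ‖(s : EuclideanSpace ℝ (Fin d)) - ζ‖ ^ 2)) ≤ M := by
  have : Nonempty S := ⟨s⟩
  refine ⟨(hf s).1.trans (self_le_iSup_penalized f lam s), ciSup_le fun ζ => ?_⟩
  have : 0 ≤ lam * ‖(s : EuclideanSpace ℝ (Fin d)) - ζ‖ ^ 2 := by positivity
  linarith [(hf ζ).2]

theorem abs_iSup_penalized_sub_le {f f' : S → ℝ} {r : ℝ} (h : ∀ s, |f s - f' s| ≤ r) (lam : ℝ)
    (s : S) : |(⨆ ζ : S, (f ζ - lam * ‖(s : EuclideanSpace ℝ (Fin d)) - ζ‖ ^ 2)) -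
      ⨆ ζ : S, (f' ζ - lam * ‖(s : EuclideanSpace ℝ (Fin d)) - ζ‖ ^ 2)| ≤ r := by
  have : Nonempty S := ⟨s⟩
  rw [abs_le, neg_le_sub_iff_le_add, sub_le_iff_le_add]
  constructor
  · refine ciSup_le fun ζ => ?_
    linarith [(abs_le.1 (h ζ)).1, le_iSup_penalized f lam s ζ]
  · refine ciSup_le fun ζ => ?_
    linarith [(abs_le.1 (h ζ)).2, le_iSup_penalized f' lam s ζ]

/-- The objective of the dual problem. -/
noncomputable def dualObjective (ε : ℝ) (P f : S → ℝ) (lam : ℝ) : ℝ :=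
  ε * lam + expect P (fun s => ⨆ ζ : S, (f ζ - lam * ‖(s : EuclideanSpace ℝ (Fin d)) - ζ‖ ^ 2))

/-- Take `ζ = s` inside the supremum. This lower bound makes the real `sInf` in `dualDRO` a genuine
infimum. -/
theorem expect_le_dualObjective {ε : ℝ} (hε : 0 ≤ ε) {P f : S → ℝ} (hP : P ∈ stdSimplex ℝ S)
    {lam : ℝ} (hlam : 0 ≤ lam) : expect P f ≤ dualObjective ε P f lam :=
  (expect_mono hP.1 fun s => self_le_iSup_penalized f lam s).trans
    (le_add_of_nonneg_left (mul_nonneg hε hlam))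

theorem dualDRO_le {ε : ℝ} (hε : 0 ≤ ε) {P f : S → ℝ} (hP : P ∈ stdSimplex ℝ S)
    {lam : ℝ} (hlam : 0 ≤ lam) : dualDRO ε P f ≤ dualObjective ε P f lam := by
  refine csInf_le ⟨expect P f, ?_⟩ ⟨lam, hlam, rfl⟩
  rintro _ ⟨l, hl, rfl⟩
  exact expect_le_dualObjective hε hP hl

theorem le_dualDRO {ε : ℝ} {P f : S → ℝ} {v : ℝ}
    (h : ∀ lam, 0 ≤ lam → v ≤ dualObjective ε P f lam) : v ≤ dualDRO ε P f := by
  refine le_csInf ⟨_, 0, Set.mem_Ici.2 le_rfl, rfl⟩ ?_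
  rintro _ ⟨l, hl, rfl⟩
  exact h l hl

theorem dualDRO_mem {ε : ℝ} (hε : 0 ≤ ε) {P f : S → ℝ} {M : ℝ} (hP : P ∈ stdSimplex ℝ S)
    (hf : ∀ s, 0 ≤ f s ∧ f s ≤ M) : 0 ≤ dualDRO ε P f ∧ dualDRO ε P f ≤ M := by
  constructor
  · exact le_dualDRO fun lam hlam =>
      (expect_nonneg hP fun s => (hf s).1).trans (expect_le_dualObjective hε hP hlam)
  · refine (dualDRO_le hε hP le_rfl).trans ?_
    rw [dualObjective, mul_zero, zero_add]
    exact expect_le hP fun s => (iSup_penalized_mem hf le_rfl s).2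

theorem abs_dualDRO_sub_le {ε : ℝ} (hε : 0 ≤ ε) {P P' f f' : S → ℝ} {r : ℝ}
    (hP : P ∈ stdSimplex ℝ S) (hP' : P' ∈ stdSimplex ℝ S)
    (h : ∀ lam, 0 ≤ lam → |dualObjective ε P f lam - dualObjective ε P' f' lam| ≤ r) :
    |dualDRO ε P f - dualDRO ε P' f'| ≤ r := by
  rw [abs_le, neg_le_sub_iff_le_add, sub_le_iff_le_add]
  constructor
  · rw [← sub_le_iff_le_add]
    refine le_dualDRO fun lam hlam => ?_
    linarith [(abs_le.1 (h lam hlam)).1, dualDRO_le (f := f') hε hP' hlam]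
  · rw [← sub_le_iff_le_add']
    refine le_dualDRO fun lam hlam => ?_
    linarith [(abs_le.1 (h lam hlam)).2, dualDRO_le (f := f) hε hP hlam]

/-- Stability of the dual value under perturbation of the reference distribution. -/
theorem abs_dualDRO_sub_le_of_forall_sum_le {ε : ℝ} (hε : 0 ≤ ε) {P P' f : S → ℝ} {M t : ℝ}
    (hP : P ∈ stdSimplex ℝ S) (hP' : P' ∈ stdSimplex ℝ S) (hf : ∀ s, 0 ≤ f s ∧ f s ≤ M)
    (h : ∀ U : Finset S, ∑ s ∈ U, P' s - ∑ s ∈ U, P s ≤ t) :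
    |dualDRO ε P' f - dualDRO ε P f| ≤ M * t := by
  refine abs_dualDRO_sub_le hε hP' hP fun lam hlam => ?_
  rw [dualObjective, dualObjective, add_sub_add_left_eq_sub]
  exact abs_expect_sub_le_of_forall_sum_le hP hP' (fun s => iSup_penalized_mem hf hlam s) h

/-- Stability of the dual value under perturbation of the cost. -/
theorem abs_dualDRO_sub_le_of_abs_sub_le {ε : ℝ} (hε : 0 ≤ ε) {P f f' : S → ℝ} {r : ℝ}
    (hP : P ∈ stdSimplex ℝ S) (h : ∀ s, |f s - f' s| ≤ r) :
    |dualDRO ε P f - dualDRO ε P f'| ≤ r := by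
  refine abs_dualDRO_sub_le hε hP hP fun lam _ => ?_
  rw [dualObjective, dualObjective, add_sub_add_left_eq_sub]
  exact abs_expect_sub_le hP fun s => abs_iSup_penalized_sub_le h lam s

/-- Lagrange multiplier for a planar convex problem under Slater's condition. -/
theorem exists_multiplier_of_convex {K : Set (ℝ × ℝ)} (hK : Convex ℝ K) {ε v : ℝ}
    (hv : ∀ p ∈ K, p.1 ≤ ε → p.2 ≤ v) (hs : ∃ p ∈ K, p.1 < ε) :
    ∃ lam : ℝ, 0 ≤ lam ∧ ∀ p ∈ K, p.2 - lam * (p.1 - ε) ≤ v := by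
  -- Slopes of the chords from `(ε, v)` to points of `K` on its right. Their supremum is the slope
  -- of a line through `(ε, v)` lying above `K`; inserting `0` makes it nonnegative.
  let R : Set ℝ := insert 0 ((fun q : ℝ × ℝ => (q.2 - v) / (q.1 - ε)) '' {q ∈ K | ε < q.1})
  have hR : ∀ p ∈ K, p.1 < ε → ∀ r ∈ R, r ≤ (v - p.2) / (ε - p.1) := by
    intro p hp hpε r hr
    have h1 : 0 < ε - p.1 := sub_pos.2 hpε
    rcases hr with rfl | ⟨q, ⟨hq, hqε⟩, rfl⟩
    · exact div_nonneg (sub_nonneg.2 (hv p hp hpε.le)) h1.le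
    · have h2 : 0 < q.1 - ε := sub_pos.2 hqε
      have h3 : 0 < q.1 - p.1 := by linarith
      -- The segment from `p` to `q` crosses the abscissa `ε`, where its height is at most `v`; this
      -- orders right slopes below left slopes.
      have hmem := hK hp hq (a := (q.1 - ε) / (q.1 - p.1)) (b := (ε - p.1) / (q.1 - p.1))
        (by positivity) (by positivity) (by field_simp; ring)
      have h4 := hv _ hmem (le_of_eq (by simp; field_simp; ring))
      simp only [Prod.snd_add, Prod.smul_snd, smul_eq_mul] at h4
      have h5 : (q.1 - ε) * p.2 + (ε - p.1) * q.2 ≤ v * (q.1 - p.1) := by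
        rw [← div_le_iff₀ h3]
        refine le_trans (le_of_eq ?_) h4
        ring
      change (q.2 - v) / (q.1 - ε) ≤ _
      rw [div_le_div_iff₀ h2 h1]
      nlinarith
  obtain ⟨p₀, hp₀, hp₀ε⟩ := hs
  have hbdd : BddAbove R := ⟨_, fun r hr => hR p₀ hp₀ hp₀ε r hr⟩
  refine ⟨sSup R, le_csSup hbdd (Set.mem_insert _ _), fun p hp => ?_⟩
  rcases lt_trichotomy p.1 ε with h | h | h
  · have := csSup_le ⟨0, Set.mem_insert _ _⟩ (hR p hp h)
    rw [le_div_iff₀ (sub_pos.2 h)] at this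
    linarith
  · rw [h]; simpa using hv p hp h.le
  · have := le_csSup hbdd (Set.mem_insert_of_mem 0 ⟨p, ⟨hp, h⟩, rfl⟩)
    rw [div_le_iff₀ (sub_pos.2 h)] at this
    linarith

/-- Transport plans with first marginal `P`. -/
def plansFrom (P : S → ℝ) : Set (S × S → ℝ) :=
  {σ | (∀ z, 0 ≤ σ z) ∧ ∀ s, ∑ t, σ (s, t) = P s}

theorem mem_couplings_of_mem_plansFrom {P : S → ℝ} (hP : P ∈ stdSimplex ℝ S) {σ : S × S → ℝ}
    (hσ : σ ∈ plansFrom P) : σ ∈ couplings P fun t => ∑ s, σ (s, t) := by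
  refine ⟨⟨hσ.1, ?_⟩, hσ.2, fun _ => rfl⟩
  rw [Fintype.sum_prod_type, Finset.sum_congr rfl fun s _ => hσ.2 s, hP.2]

/-- Every map `T : S → S` transports `P` along a plan. -/
theorem exists_plan_of_map {P : S → ℝ} (hP : P ∈ stdSimplex ℝ S) (T : S → S) :
    ∃ σ ∈ plansFrom P, ∀ k : S × S → ℝ, expect σ k = expect P fun s => k (s, T s) := by
  classical
  refine ⟨fun z => if z.2 = T z.1 then P z.1 else 0, ⟨fun z => ?_, fun s => by simp⟩, fun k => ?_⟩
  · dsimp only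
    split_ifs
    exacts [hP.1 _, le_rfl]
  · simp [expect, Fintype.sum_prod_type, ite_mul]

theorem expect_snd_marginal (σ : S × S → ℝ) (f : S → ℝ) :
    expect (fun t => ∑ s, σ (s, t)) f = expect σ fun z => f z.2 := by
  simp only [expect, Finset.sum_mul, Fintype.sum_prod_type]
  exact Finset.sum_comm

theorem bddBelow_transportCosts (P Q : S → ℝ) :
    BddBelow ((fun σ : S × S → ℝ =>
      expect σ (fun z => ‖(z.1 : EuclideanSpace ℝ (Fin d)) - z.2‖ ^ 2)) '' couplings P Q) := by
  refine ⟨0, ?_⟩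
  rintro _ ⟨σ, hσ, rfl⟩
  exact expect_nonneg hσ.1 fun z => by positivity

theorem mem_uncertaintySet_of_plan {ε : ℝ} {P : S → ℝ} (hP : P ∈ stdSimplex ℝ S)
    {σ : S × S → ℝ} (hσ : σ ∈ plansFrom P)
    (hc : expect σ (fun z => ‖(z.1 : EuclideanSpace ℝ (Fin d)) - z.2‖ ^ 2) ≤ ε) :
    (fun t => ∑ s, σ (s, t)) ∈ uncertaintySet ε P := by
  have hcoup := mem_couplings_of_mem_plansFrom hP hσ
  refine ⟨⟨fun t => Finset.sum_nonneg fun s _ => hσ.1 _, ?_⟩, ?_⟩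
  · rw [Finset.sum_comm, ← Fintype.sum_prod_type, hcoup.1.2]
  · exact (csInf_le (bddBelow_transportCosts _ _) ⟨σ, hcoup, rfl⟩).trans hc

theorem couplings_nonempty {P Q : S → ℝ} (hP : P ∈ stdSimplex ℝ S) (hQ : Q ∈ stdSimplex ℝ S) :
    (couplings P Q).Nonempty := by
  refine ⟨fun z => P z.1 * Q z.2, ⟨fun z => mul_nonneg (hP.1 _) (hQ.1 _), ?_⟩, fun s => ?_,
    fun t => ?_⟩
  · simp only [Fintype.sum_prod_type, ← Finset.mul_sum, hP.2, hQ.2, mul_one]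
  · simp only [← Finset.mul_sum, hQ.2, mul_one]
  · simp only [← Finset.sum_mul, hP.2, one_mul]

theorem weak_duality {ε : ℝ} {P Q f : S → ℝ} (hP : P ∈ stdSimplex ℝ S)
    (hQ : Q ∈ uncertaintySet ε P) {lam : ℝ} (hlam : 0 ≤ lam) :
    expect Q f ≤ dualObjective ε P f lam := by
  refine le_of_forall_pos_le_add fun η hη => ?_
  -- A nearly optimal plan avoids proving that the transport infimum is attained. The slack `η /
  -- (lam + 1)` stays below `η` after multiplication by `lam`, even when `lam = 0`.
  obtain ⟨_, ⟨σ, hσ, rfl⟩, hlt⟩ := exists_lt_of_csInf_lt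
    ((couplings_nonempty hP hQ.1).image _)
    (lt_of_le_of_lt hQ.2 (show ε < ε + η / (lam + 1) by
      have : 0 < η / (lam + 1) := by positivity
      linarith))
  have h1 : expect Q f = expect σ fun z => f z.2 := by
    rw [← expect_snd_marginal]
    congr 1
    exact (funext hσ.2.2).symm
  have h2 : expect σ (fun z => f z.2 - lam * ‖(z.1 : EuclideanSpace ℝ (Fin d)) - z.2‖ ^ 2) ≤
      expect P (fun s =>
        ⨆ ζ : S, (f ζ - lam * ‖(s : EuclideanSpace ℝ (Fin d)) - ζ‖ ^ 2)) := by
    refine (expect_mono hσ.1.1 fun z => le_iSup_penalized f lam z.1 z.2).trans_eq ?_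
    simp only [expect, Fintype.sum_prod_type, ← Finset.sum_mul, hσ.2.1]
  have h3 : expect σ (fun z => lam * ‖(z.1 : EuclideanSpace ℝ (Fin d)) - z.2‖ ^ 2) =
      lam * expect σ (fun z => ‖(z.1 : EuclideanSpace ℝ (Fin d)) - z.2‖ ^ 2) := by
    simp only [expect, Finset.mul_sum]
    exact Finset.sum_congr rfl fun z _ => by ring
  rw [expect_sub, h3] at h2
  have h4 : lam * (η / (lam + 1)) ≤ η := by
    rw [mul_div_assoc', div_le_iff₀ (by positivity)]
    nlinarith
  have h5 := mul_le_mul_of_nonneg_left hlt.le hlam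
  rw [h1, dualObjective]
  dsimp only at h5
  linarith

theorem mem_uncertaintySet_self {ε : ℝ} (hε : 0 ≤ ε) {P : S → ℝ} (hP : P ∈ stdSimplex ℝ S) :
    P ∈ uncertaintySet ε P := by
  refine ⟨hP, ?_⟩
  classical
  refine (csInf_le (bddBelow_transportCosts _ _)
    ⟨fun z => if z.2 = z.1 then P z.1 else 0, ⟨⟨fun z => ?_, ?_⟩, ?_, ?_⟩, rfl⟩).trans ?_
  · dsimp only
    split_ifs
    exacts [hP.1 _, le_rfl]
  · simpa [Fintype.sum_prod_type] using hP.2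
  · simp
  · simp
  · simpa [expect, Fintype.sum_prod_type] using hε

/-- Strong duality for Wasserstein distributionally robust optimization on a finite set. -/
theorem primalDRO_eq_dualDRO {ε : ℝ} (hε : 0 < ε) {P : S → ℝ} (hP : P ∈ stdSimplex ℝ S)
    (f : S → ℝ) : primalDRO ε P f = dualDRO ε P f := by
  have hbdd : BddAbove ((fun Q : S → ℝ => expect Q f) '' uncertaintySet ε P) := by
    refine ⟨dualObjective ε P f 0, ?_⟩
    rintro _ ⟨Q, hQ, rfl⟩
    exact weak_duality hP hQ le_rfl
  apply le_antisymm
  · refine csSup_le ⟨_, P, mem_uncertaintySet_self hε.le hP, rfl⟩ ?_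
    rintro _ ⟨Q, hQ, rfl⟩
    exact le_dualDRO fun lam hlam => weak_duality hP hQ hlam
  · let c : S × S → ℝ := fun z => ‖(z.1 : EuclideanSpace ℝ (Fin d)) - z.2‖ ^ 2
    -- Pairs (transport cost, reward) over all plans leaving `P`. The primal is a planar convex
    -- problem on `K`, and the identity plan of cost `0 < ε` is the Slater point.
    let K : Set (ℝ × ℝ) := (fun σ => (expect σ c, expect σ fun z => f z.2)) '' plansFrom P
    have hK : Convex ℝ K := by
      rintro _ ⟨σ, hσ, rfl⟩ _ ⟨τ, hτ, rfl⟩ a b ha hb hab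
      refine ⟨a • σ + b • τ, ⟨fun z => ?_, fun s => ?_⟩, ?_⟩
      · exact add_nonneg (mul_nonneg ha (hσ.1 z)) (mul_nonneg hb (hτ.1 z))
      · simp only [Pi.add_apply, Pi.smul_apply, smul_eq_mul, Finset.sum_add_distrib,
          ← Finset.mul_sum, hσ.2, hτ.2, ← add_mul, hab, one_mul]
      · simp [expect, Finset.mul_sum, add_mul, mul_assoc, Finset.sum_add_distrib]
    obtain ⟨lam, hlam, hmul⟩ := exists_multiplier_of_convex hK (ε := ε) (v := primalDRO ε P f)
      (by
        rintro _ ⟨σ, hσ, rfl⟩ hc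
        refine le_csSup hbdd ⟨_, mem_uncertaintySet_of_plan hP hσ hc, ?_⟩
        exact expect_snd_marginal σ f)
      (by
        obtain ⟨σ, hσ, hk⟩ := exists_plan_of_map hP id
        refine ⟨_, ⟨σ, hσ, rfl⟩, ?_⟩
        dsimp only
        rw [hk]
        simpa [c, expect] using hε)
    have := nonempty_of_mem_stdSimplex hP
    -- Moving each `s` to a maximizer of the penalized reward gives a plan whose Lagrangian equals
    -- the dual objective at `lam`.
    choose T hT using fun s : S => exists_eq_ciSup_of_finite
      (f := fun ζ : S => f ζ - lam * ‖(s : EuclideanSpace ℝ (Fin d)) - ζ‖ ^ 2)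
    obtain ⟨σ, hσ, hk⟩ := exists_plan_of_map hP T
    have := hmul _ ⟨σ, hσ, rfl⟩
    refine (dualDRO_le hε.le hP hlam).trans (le_trans (le_of_eq ?_) this)
    simp only [dualObjective, ← hT, hk, expect_sub, c]
    simp only [expect, mul_sub, Finset.mul_sum]
    rw [Finset.sum_congr rfl fun s _ => mul_left_comm (P s) lam _]
    ring

end Duality


/-! ### Exponential moments and Chernoff bounds -/

/-- Hoeffding's lemma for a probability vector on a finite type. -/
theorem expect_exp_centered_le {S : Type*} [Fintype S] {Q g : S → ℝ} (hQ : Q ∈ stdSimplex ℝ S)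
    (hg : ∀ s, 0 ≤ g s ∧ g s ≤ 1) (lam : ℝ) :
    expect Q (fun s => Real.exp (lam * (g s - expect Q g))) ≤ Real.exp (lam ^ 2 / 8) := by
  classical
  let _ : MeasurableSpace S := ⊤
  let ν : Measure S := ∑ s, ENNReal.ofReal (Q s) • Measure.dirac s
  have hν : ∀ s, ν {s} = ENNReal.ofReal (Q s) := by
    intro s
    simp [ν, Measure.finsetSum_apply, Set.indicator_apply]
  have hνr : ∀ s, ν.real {s} = Q s := by
    intro s
    rw [measureReal_def, hν, ENNReal.toReal_ofReal (hQ.1 s)]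
  have : IsProbabilityMeasure ν := by
    refine ⟨?_⟩
    simp only [ν, Measure.finsetSum_apply, Measure.smul_apply, measure_univ, smul_eq_mul, mul_one]
    rw [← ENNReal.ofReal_sum_of_nonneg fun s _ => hQ.1 s, hQ.2, ENNReal.ofReal_one]
  have hint : ∀ f : S → ℝ, ∫ s, f s ∂ν = expect Q f := by
    intro f
    rw [integral_fintype .of_finite]
    simp [hνr, expect]
  -- An interval of length one has variance proxy `(1 / 2) ^ 2`, hence the exponent `lam ^ 2 / 8`.
  have h := (hasSubgaussianMGF_of_mem_Icc (μ := ν) (X := g) (a := 0) (b := 1)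
    (measurable_of_finite g).aemeasurable (Filter.Eventually.of_forall hg)).mgf_le lam
  rw [mgf, hint, hint] at h
  refine h.trans_eq ?_
  congr 1
  simp
  ring

section Chernoff

variable {T Ω : Type*} [Fintype T] [MeasurableSpace T] [MeasurableSingletonClass T]
  [MeasurableSpace Ω] {μ : Measure Ω} [IsProbabilityMeasure μ] {n : ℕ} {D : Fin n → Ω → T}

theorem integral_comp_eq_expect {X : Ω → T} (hX : Measurable X) {p : T → ℝ}
    (hp : ∀ t, μ.real {ω | X ω = t} = p t) (F : T → ℝ) :
    ∫ ω, F (X ω) ∂μ = expect p F := by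
  have : IsProbabilityMeasure (μ.map X) := Measure.isProbabilityMeasure_map hX.aemeasurable
  rw [← integral_map (f := F) hX.aemeasurable (measurable_of_finite F).aestronglyMeasurable,
    integral_fintype .of_finite]
  refine Finset.sum_congr rfl fun t _ => ?_
  rw [map_measureReal_apply hX (measurableSet_singleton t), ← hp t]
  rfl

/-- Chernoff's bound for i.i.d. samples from a finite type. -/
theorem measureReal_le_sum_le_exp_neg (hm : ∀ i, Measurable (D i)) (hD : iIndepFun D μ)
    {p : T → ℝ} (hp : ∀ i t, μ.real {ω | D i ω = t} = p t) {F : T → ℝ}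
    (hF : expect p (fun t => Real.exp (F t)) ≤ 1) (s : ℝ) :
    μ.real {ω | s ≤ ∑ i, F (D i ω)} ≤ Real.exp (-s) := by
  have hFm : Measurable F := measurable_of_finite F
  have hind : iIndepFun (fun i ω => F (D i ω)) μ := hD.comp (fun _ => F) fun _ => hFm
  have hmgf : mgf (∑ i, fun ω => F (D i ω)) μ 1 ≤ 1 := by
    rw [hind.mgf_sum fun i => hFm.comp (hm i)]
    refine Finset.prod_le_one (fun i _ => mgf_nonneg) fun i _ => ?_
    simp only [mgf, one_mul]
    rwa [integral_comp_eq_expect (hm i) (hp i) fun t => Real.exp (F t)]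
  have hbound : ∃ b, ∀ t, F t ≤ b := by
    obtain ⟨b, hb⟩ := (Set.finite_range F).bddAbove
    exact ⟨b, fun t => hb ⟨t, rfl⟩⟩
  obtain ⟨b, hb⟩ := hbound
  have hmeas : Measurable fun ω => ∑ i, F (D i ω) :=
    Finset.measurable_sum _ fun i _ => hFm.comp (hm i)
  have hint : Integrable (fun ω => Real.exp (1 * (∑ i, fun ω => F (D i ω)) ω)) μ := by
    simp only [one_mul, Finset.sum_apply]
    refine Integrable.of_bound (Real.measurable_exp.comp hmeas).aestronglyMeasurable
      (Real.exp (∑ _i : Fin n, b)) (Filter.Eventually.of_forall fun ω => ?_)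
    rw [Real.norm_of_nonneg (Real.exp_pos _).le, Real.exp_le_exp]
    exact Finset.sum_le_sum fun i _ => hb _
  have h := measure_ge_le_exp_mul_mgf s zero_le_one hint
  simp only [Finset.sum_apply] at h
  refine h.trans ?_
  rw [neg_one_mul]
  exact mul_le_of_le_one_right (Real.exp_pos _).le hmgf

end Chernoff

/-! ### Empirical frequencies as sums over samples -/

open Classical in
/-- The number of samples with context `x` and action `a`. -/
noncomputable def pairCount {X A Z : Type*} {n : ℕ} (D : Fin n → X × A × Z) (x : X) (a : A) : ℝ :=
  ((Finset.univ.filter (fun i => (D i).1 = x ∧ (D i).2.1 = a)).card : ℝ)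

section Empirical

variable {X A Z : Type*} {n : ℕ}

open Classical in
theorem natCast_mul_sum_empContext (hn : n ≠ 0) (D : Fin n → X × A × Z) (U : Finset X) :
    (n : ℝ) * ∑ x ∈ U, empContext D x = ∑ i, if (D i).1 ∈ U then 1 else 0 := by
  have hn' : (n : ℝ) ≠ 0 := Nat.cast_ne_zero.2 hn
  simp only [empContext, ← Finset.sum_div, mul_div_cancel₀ _ hn',
    Finset.natCast_card_filter]
  rw [Finset.sum_comm]
  simp

open Classical in
theorem pairCount_mul_sum_empOutcome (D : Fin n → X × A × Z) {x : X} {a : A}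
    (h : pairCount D x a ≠ 0) (U : Finset Z) :
    pairCount D x a * ∑ z ∈ U, empOutcome D x a z =
      ∑ i, if (D i).1 = x ∧ (D i).2.1 = a ∧ (D i).2.2 ∈ U then 1 else 0 := by
  have : ∀ z, empOutcome D x a z =
    ((Finset.univ.filter (fun i => D i = (x, a, z))).card : ℝ) / pairCount D x a := fun _ => rfl
  simp only [this, ← Finset.sum_div]
  rw [mul_div_cancel₀ _ h]
  simp only [Finset.natCast_card_filter]
  rw [Finset.sum_comm]
  refine Finset.sum_congr rfl fun i _ => ?_
  simp only [Prod.ext_iff]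
  by_cases h1 : (D i).1 = x <;> by_cases h2 : (D i).2.1 = a <;> simp [h1, h2]

theorem empContext_mem_stdSimplex [Fintype X] (hn : n ≠ 0) (D : Fin n → X × A × Z) :
    empContext D ∈ stdSimplex ℝ X := by
  refine ⟨fun x => div_nonneg (Nat.cast_nonneg _) (Nat.cast_nonneg _), ?_⟩
  have h := natCast_mul_sum_empContext hn D Finset.univ
  have hn' : (n : ℝ) ≠ 0 := Nat.cast_ne_zero.2 hn
  simp only [Finset.mem_univ, if_true, Finset.sum_const, Finset.card_univ, Fintype.card_fin,
    nsmul_eq_mul, mul_one] at h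
  exact (mul_eq_left₀ hn').1 h

open Classical in
theorem pairCount_eq_sum (D : Fin n → X × A × Z) (x : X) (a : A) :
    pairCount D x a = ∑ i, if (D i).1 = x ∧ (D i).2.1 = a then 1 else 0 := by
  rw [pairCount, Finset.natCast_card_filter]

theorem empOutcome_mem_stdSimplex [Fintype Z] (D : Fin n → X × A × Z) {x : X} {a : A}
    (h : pairCount D x a ≠ 0) : empOutcome D x a ∈ stdSimplex ℝ Z := by
  refine ⟨fun z => div_nonneg (Nat.cast_nonneg _) (Nat.cast_nonneg _), ?_⟩
  refine (mul_eq_left₀ h).1 ((pairCount_mul_sum_empOutcome D h Finset.univ).trans ?_)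
  rw [pairCount_eq_sum]
  refine Finset.sum_congr rfl fun i _ => ?_
  split_ifs with h₁ h₂ h₂
  exacts [rfl, (h₂ ⟨h₁.1, h₁.2.1⟩).elim, (h₁ ⟨h₂.1, h₂.2, Finset.mem_univ _⟩).elim, rfl]

end Empirical

/-- Union bound over all events; its factor is the price of total variation. -/
theorem measureReal_exists_finset_le {S Ω : Type*} [Fintype S] [MeasurableSpace Ω]
    {μ : Measure Ω} {E : Finset S → Set Ω} {r : ℝ}
    (h : ∀ U, μ.real (E U) ≤ r) : μ.real {ω | ∃ U, ω ∈ E U} ≤ 2 ^ Fintype.card S * r := by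
  classical
  have : {ω | ∃ U, ω ∈ E U} = ⋃ U, E U := by ext; simp
  rw [this]
  refine (measureReal_iUnion_fintype_le E).trans ((Finset.sum_le_sum fun U _ => h U).trans_eq ?_)
  simp

/-! ### Concentration of contexts, counts and outcomes -/

section Concentration

variable {X A Z Ω : Type*} [Fintype X] [Fintype A] [Fintype Z]
  {P₀ : X → ℝ} {π₀ : X → A → ℝ} {Q₀ : X → A → Z → ℝ}

/-- The joint law of context, action and outcome. -/
def jointLaw (P₀ : X → ℝ) (π₀ : X → A → ℝ) (Q₀ : X → A → Z → ℝ) (t : X × A × Z) : ℝ :=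
  P₀ t.1 * π₀ t.1 t.2.1 * Q₀ t.1 t.2.1 t.2.2

theorem expect_jointLaw (F : X × A × Z → ℝ) : expect (jointLaw P₀ π₀ Q₀) F =
    expect P₀ fun x => expect (π₀ x) fun a => expect (Q₀ x a) fun z => F (x, a, z) := by
  simp only [expect, jointLaw, Fintype.sum_prod_type, Finset.mul_sum, mul_assoc]

theorem jointLaw_mem_stdSimplex (hP : P₀ ∈ stdSimplex ℝ X) (hπ : ∀ x, π₀ x ∈ stdSimplex ℝ A)
    (hQ : ∀ x a, Q₀ x a ∈ stdSimplex ℝ Z) : jointLaw P₀ π₀ Q₀ ∈ stdSimplex ℝ (X × A × Z) := by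
  refine ⟨fun t => mul_nonneg (mul_nonneg (hP.1 _) ((hπ _).1 _)) ((hQ _ _).1 _), ?_⟩
  have h := expect_jointLaw (P₀ := P₀) (π₀ := π₀) (Q₀ := Q₀) fun _ => 1
  simp only [expect_const (hQ _ _), expect_const (hπ _), expect_const hP] at h
  simpa [expect] using h

theorem expect_exp_sub_le_one {S : Type*} [Fintype S] {Q g : S → ℝ} (hQ : Q ∈ stdSimplex ℝ S)
    (hg : ∀ s, 0 ≤ g s ∧ g s ≤ 1) (lam : ℝ) :
    expect Q (fun s => Real.exp (lam * (g s - expect Q g) - lam ^ 2 / 8)) ≤ 1 := by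
  have h := expect_exp_centered_le hQ hg lam
  simp only [Real.exp_sub, expect, mul_div_assoc'] at h ⊢
  rw [← Finset.sum_div]
  exact div_le_one_of_le₀ h (Real.exp_pos _).le

variable [MeasurableSpace X] [MeasurableSingletonClass X] [MeasurableSpace A]
  [MeasurableSingletonClass A] [MeasurableSpace Z] [MeasurableSingletonClass Z]
  [MeasurableSpace Ω] {μ : Measure Ω} [IsProbabilityMeasure μ] {n : ℕ} {D : Fin n → Ω → X × A × Z}

theorem IsLoggedData.measureReal_le (hD : IsLoggedData P₀ π₀ Q₀ μ D) {F : X × A × Z → ℝ}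
    (hF : expect (jointLaw P₀ π₀ Q₀) (fun t => Real.exp (F t)) ≤ 1) {s : ℝ} {E : Set Ω}
    (hE : ∀ ω ∈ E, s ≤ ∑ i, F (D i ω)) : μ.real E ≤ Real.exp (-s) :=
  (measureReal_mono hE).trans
    (measureReal_le_sum_le_exp_neg hD.1 hD.2.1 (fun i t => hD.2.2 i t.1 t.2.1 t.2.2) hF s)

theorem IsLoggedData.measureReal_empContext_le (hD : IsLoggedData P₀ π₀ Q₀ μ D) (hn : n ≠ 0)
    (hP : P₀ ∈ stdSimplex ℝ X) (hπ : ∀ x, π₀ x ∈ stdSimplex ℝ A)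
    (hQ : ∀ x a, Q₀ x a ∈ stdSimplex ℝ Z) {t : ℝ} (ht : 0 ≤ t) (U : Finset X) :
    μ.real {ω | t ≤ ∑ x ∈ U, empContext (fun i => D i ω) x - ∑ x ∈ U, P₀ x} ≤
      Real.exp (-(2 * n * t ^ 2)) := by
  classical
  let g : X × A × Z → ℝ := fun s => if s.1 ∈ U then 1 else 0
  have hg : expect (jointLaw P₀ π₀ Q₀) g = ∑ x ∈ U, P₀ x := by
    rw [expect_jointLaw]
    simp [expect, g, (hQ _ _).2, (hπ _).2]
  -- The parameter `4 * t` maximizes `lam * t - lam ^ 2 / 8`, with value `2 * t ^ 2` per sample.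
  refine hD.measureReal_le (expect_exp_sub_le_one (g := g) (jointLaw_mem_stdSimplex hP hπ hQ)
    (fun s => ?_) (4 * t)) fun ω hω => ?_
  · dsimp only [g]
    split_ifs <;> simp
  · have h := natCast_mul_sum_empContext hn (fun i => D i ω) U
    have h' := mul_le_mul_of_nonneg_left (Set.mem_ofPred_eq ▸ hω)
      (mul_nonneg ht (Nat.cast_nonneg (α := ℝ) n))
    simp only [Finset.sum_sub_distrib, ← Finset.mul_sum, hg, g, ← h, Finset.sum_const,
      Finset.card_univ, Fintype.card_fin, nsmul_eq_mul]
    linarith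

theorem IsLoggedData.measureReal_pairCount_le (hD : IsLoggedData P₀ π₀ Q₀ μ D)
    (hP : P₀ ∈ stdSimplex ℝ X) (hπ : ∀ x, π₀ x ∈ stdSimplex ℝ A)
    (hQ : ∀ x a, Q₀ x a ∈ stdSimplex ℝ Z) {x : X} {a : A} {r : ℝ} (hr : 0 ≤ r)
    (hrp : r ≤ P₀ x * π₀ x a) :
    μ.real {ω | pairCount (fun i => D i ω) x a < n * r / 2} ≤ Real.exp (-(n * r ^ 2 / 2)) := by
  classical
  let g : X × A × Z → ℝ := fun s => if s.1 = x ∧ s.2.1 = a then 1 else 0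
  have hg : expect (jointLaw P₀ π₀ Q₀) g = P₀ x * π₀ x a := by
    rw [expect_jointLaw]
    simp [expect, g, ite_and, (hQ _ _).2]
  -- A count below `n * r / 2` falls short of its mean by at least `r / 2` per sample; the optimal
  -- parameter is `-(2 * r)`.
  refine hD.measureReal_le (expect_exp_sub_le_one (g := g) (jointLaw_mem_stdSimplex hP hπ hQ)
    (fun s => ?_) (-(2 * r))) fun ω hω => ?_
  · dsimp only [g]
    split_ifs <;> simp
  · have h := pairCount_eq_sum (fun i => D i ω) x a
    have h' := mul_le_mul_of_nonneg_left (le_of_lt (Set.mem_ofPred_eq ▸ hω)) hr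
    have h'' := mul_le_mul_of_nonneg_left hrp (mul_nonneg hr (Nat.cast_nonneg (α := ℝ) n))
    simp only [Finset.sum_sub_distrib, ← Finset.mul_sum, hg, g, ← h, Finset.sum_const,
      Finset.card_univ, Fintype.card_fin, nsmul_eq_mul]
    linarith

/-- The weight `exp F` equals one off the cell and has conditional mean at most one on it, so
Chernoff applies to all `n` samples without conditioning on which fall in the cell. With `N` samples
there and deviation at least `t`, the sum of `F` is at least `2 * N * t ^ 2`. -/
theorem IsLoggedData.measureReal_empOutcome_le (hD : IsLoggedData P₀ π₀ Q₀ μ D)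
    (hP : P₀ ∈ stdSimplex ℝ X) (hπ : ∀ x, π₀ x ∈ stdSimplex ℝ A)
    (hQ : ∀ x a, Q₀ x a ∈ stdSimplex ℝ Z) (x : X) (a : A) {t m : ℝ} (ht : 0 ≤ t) (hm : 0 < m)
    (U : Finset Z) :
    μ.real {ω | m ≤ pairCount (fun i => D i ω) x a ∧
      t ≤ ∑ z ∈ U, empOutcome (fun i => D i ω) x a z - ∑ z ∈ U, Q₀ x a z} ≤
      Real.exp (-(2 * m * t ^ 2)) := by
  classical
  let g : Z → ℝ := fun z => if z ∈ U then 1 else 0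
  have hg : expect (Q₀ x a) g = ∑ z ∈ U, Q₀ x a z := by simp [expect, g]
  let q : ℝ := ∑ z ∈ U, Q₀ x a z
  let F : X × A × Z → ℝ := fun s =>
    if s.1 = x ∧ s.2.1 = a then 4 * t * (g s.2.2 - q) - (4 * t) ^ 2 / 8 else 0
  refine hD.measureReal_le (F := F) ?_ fun ω hω => ?_
  · rw [expect_jointLaw]
    refine expect_le hP fun x' => expect_le (hπ x') fun a' => ?_
    by_cases hxa : x' = x ∧ a' = a
    · obtain ⟨rfl, rfl⟩ := hxa
      simp only [F, if_true, and_self, q, ← hg]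
      refine expect_exp_sub_le_one (hQ _ _) (fun z => ?_) _
      dsimp only [g]
      split_ifs <;> simp
    · simp only [F, hxa, if_false, Real.exp_zero]
      exact (expect_const (hQ _ _) 1).le
  · obtain ⟨h1, h2⟩ := hω
    have hN : 0 < pairCount (fun i => D i ω) x a := hm.trans_le h1
    have h3 := pairCount_mul_sum_empOutcome (fun i => D i ω) hN.ne' U
    have h4 := pairCount_eq_sum (fun i => D i ω) x a
    have h5 : ∑ i, F (D i ω) =
        4 * t * (∑ i, if (D i ω).1 = x ∧ (D i ω).2.1 = a ∧ (D i ω).2.2 ∈ U then 1 else 0) -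
        (4 * t * q + 2 * t ^ 2) * ∑ i, if (D i ω).1 = x ∧ (D i ω).2.1 = a then 1 else 0 := by
      simp only [Finset.mul_sum, ← Finset.sum_sub_distrib]
      refine Finset.sum_congr rfl fun i _ => ?_
      by_cases h1 : (D i ω).1 = x <;> by_cases h2 : (D i ω).2.1 = a <;> simp [F, g, h1, h2]
      split_ifs <;> ring
    rw [h5, ← h3, ← h4]
    have h6 := mul_le_mul_of_nonneg_left h2 (mul_nonneg ht hN.le)
    have h7 := mul_le_mul_of_nonneg_left h1 (sq_nonneg t)
    simp only [q]
    linarith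

end Concentration


/-! ### From concentration to the high-probability bound -/

/-- Since `2 ≤ e`, the number of events costs at most `k` in the exponent. The form `4 * L + 2 * k`
matches the chosen deviations `t₁` and `t₂`. -/
theorem two_pow_mul_exp_neg_le {k : ℕ} {L s : ℝ} (hL : 0 ≤ L) (hs : 4 * L + 2 * k ≤ s) :
    2 ^ k * Real.exp (-s) ≤ Real.exp (-L) := by
  have h2 : (2 : ℝ) ^ k ≤ Real.exp k := by
    rw [← Real.exp_one_pow]
    exact pow_le_pow_left₀ zero_le_two (by linarith [Real.add_one_le_exp 1]) k
  calc 2 ^ k * Real.exp (-s) ≤ Real.exp k * Real.exp (-s) :=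
        mul_le_mul_of_nonneg_right h2 (Real.exp_pos _).le
    _ = Real.exp (k - s) := by rw [← Real.exp_add, sub_eq_add_neg]
    _ ≤ Real.exp (-L) := Real.exp_le_exp.2 (by linarith [Nat.cast_nonneg (α := ℝ) k])

theorem add_le_sq_sqrt_add_sqrt {a b : ℝ} (ha : 0 ≤ a) (hb : 0 ≤ b) : a + b ≤ (√a + √b) ^ 2 := by
  nlinarith [Real.sq_sqrt ha, Real.sq_sqrt hb, mul_nonneg (Real.sqrt_nonneg a) (Real.sqrt_nonneg b)]

/-- On datasets whose empirical distributions are close to the true ones, the empirical policy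
value is close to the policy value. -/
theorem abs_empPolicyValue_sub_policyValue_le {d e : ℕ} {𝒳 : Finset (EuclideanSpace ℝ (Fin d))}
    {Ξ : Finset (EuclideanSpace ℝ (Fin e))} {A : Type*} [Fintype A] {P₀ : 𝒳 → ℝ}
    {Q₀ y : 𝒳 → A → Ξ → ℝ} {π : 𝒳 → A → ℝ} {εx εc Ymax t₁ t₂ : ℝ} {n : ℕ} (hn : n ≠ 0)
    (D : Fin n → 𝒳 × A × Ξ) (hP : P₀ ∈ stdSimplex ℝ 𝒳) (hQ : ∀ x a, Q₀ x a ∈ stdSimplex ℝ Ξ)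
    (hπ : ∀ x, π x ∈ stdSimplex ℝ A) (hy : ∀ x a ξ, 0 ≤ y x a ξ ∧ y x a ξ ≤ Ymax)
    (hεx : 0 < εx) (hεc : 0 < εc)
    (h₁ : ∀ U : Finset 𝒳, ∑ x ∈ U, empContext D x - ∑ x ∈ U, P₀ x ≤ t₁)
    (hN : ∀ x a, pairCount D x a ≠ 0)
    (h₂ : ∀ x a, ∀ U : Finset Ξ, ∑ z ∈ U, empOutcome D x a z - ∑ z ∈ U, Q₀ x a z ≤ t₂) :
    |empPolicyValue εx εc D y π - policyValue εx εc P₀ Q₀ y π| ≤ Ymax * (t₁ + t₂) := by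
  have hPn := empContext_mem_stdSimplex hn D
  rw [policyValue, empPolicyValue, primalDRO_eq_dualDRO hεx hP]
  simp only [primalDRO_eq_dualDRO hεc (hQ _ _)]
  have hm := fun x a => dualDRO_mem hεc.le (hQ x a) (hy x a)
  have hinner : ∀ x, |expect (π x) (fun a => dualDRO εc (empOutcome D x a) (y x a)) -
      expect (π x) (fun a => dualDRO εc (Q₀ x a) (y x a))| ≤ Ymax * t₂ := fun x =>
    abs_expect_sub_le (hπ x) fun a => abs_dualDRO_sub_le_of_forall_sum_le hεc.le (hQ x a)
      (empOutcome_mem_stdSimplex D (hN x a)) (hy x a) (h₂ x a)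
  -- The intermediate value uses the empirical context law with the true inner cost.
  have hcost := abs_dualDRO_sub_le_of_abs_sub_le hεx.le hPn hinner
  have hctx := abs_dualDRO_sub_le_of_forall_sum_le hεx.le hP hPn
    (f := fun x => expect (π x) fun a => dualDRO εc (Q₀ x a) (y x a))
    (fun x => ⟨expect_nonneg (hπ x) fun a => (hm x a).1, expect_le (hπ x) fun a => (hm x a).2⟩) h₁
  refine (abs_sub_le _ _ _).trans ((add_le_add hcost hctx).trans_eq ?_)
  ring

/-- The failure budget is `δ / 2` for contexts; each cell gets `δ / (4 * |𝒳| * |A|)` for its count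
and as much for its outcomes. -/
theorem measureReal_abs_sub_policyValue_ge {Ymax μπ μx : ℝ} (hμπ : 0 < μπ) (hμx : 0 < μx)
    {d e : ℕ} {𝒳 : Finset (EuclideanSpace ℝ (Fin d))} {Ξ : Finset (EuclideanSpace ℝ (Fin e))}
    {A : Type*} [Fintype A] [MeasurableSpace A] [MeasurableSingletonClass A]
    {P₀ : 𝒳 → ℝ} {π₀ : 𝒳 → A → ℝ} {Q₀ y : 𝒳 → A → Ξ → ℝ} {π : 𝒳 → A → ℝ} {εx εc δ : ℝ} {n : ℕ}
    {Ω : Type*} [MeasurableSpace Ω] {μ : Measure Ω} [IsProbabilityMeasure μ]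
    {D : Fin n → Ω → 𝒳 × A × Ξ} (hP : P₀ ∈ stdSimplex ℝ 𝒳) (hπ₀ : ∀ x, π₀ x ∈ stdSimplex ℝ A)
    (hQ : ∀ x a, Q₀ x a ∈ stdSimplex ℝ Ξ) (hπ : ∀ x, π x ∈ stdSimplex ℝ A)
    (hπ₀' : ∀ x a, μπ ≤ π₀ x a) (hP' : ∀ x, μx ≤ P₀ x)
    (hy : ∀ x a ξ, 0 ≤ y x a ξ ∧ y x a ξ ≤ Ymax) (hεx : 0 < εx) (hεc : 0 < εc)
    (hδ : 0 < δ) (hδ1 : δ < 1) (hD : IsLoggedData P₀ π₀ Q₀ μ D)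
    (hn : 2 * Real.log (4 * 𝒳.card * Fintype.card A / δ) / (μπ * μx) ^ 2 ≤ n) :
    1 - δ ≤ μ.real {ω | |empPolicyValue εx εc (fun i => D i ω) y π
          - policyValue εx εc P₀ Q₀ y π|
        ≤ opeBound Ymax μπ μx δ n 𝒳.card (Fintype.card A) Ξ.card} := by
  obtain ⟨x₀⟩ := nonempty_of_mem_stdSimplex hP
  obtain ⟨a₀⟩ := nonempty_of_mem_stdSimplex (hπ₀ x₀)
  have hX : (1 : ℝ) ≤ 𝒳.card := by
    exact_mod_cast Finset.card_pos.2 (⟨x₀.1, x₀.2⟩ : 𝒳.Nonempty)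
  have hA : (1 : ℝ) ≤ Fintype.card A := by exact_mod_cast Fintype.card_pos_iff.2 ⟨a₀⟩
  have hXA : (1 : ℝ) ≤ 𝒳.card * Fintype.card A := one_le_mul_of_one_le_of_one_le hX hA
  set L₁ : ℝ := Real.log (2 / δ) with hL₁
  set L₂ : ℝ := Real.log (4 * 𝒳.card * Fintype.card A / δ) with hL₂
  set r : ℝ := μπ * μx with hr
  have hr0 : 0 < r := mul_pos hμπ hμx
  have hL₁0 : 0 ≤ L₁ := Real.log_nonneg (by rw [le_div_iff₀ hδ]; linarith)
  have hL₂0 : 0 < L₂ := Real.log_pos (by rw [lt_div_iff₀ hδ]; linarith)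
  have hn0 : (0 : ℝ) < n := lt_of_lt_of_le (by positivity) hn
  have hn0' : n ≠ 0 := by exact_mod_cast hn0.ne'
  have hexp₁ : Real.exp (-L₁) = δ / 2 := by
    rw [hL₁, Real.exp_neg, Real.exp_log (by positivity), inv_div]
  have hexp₂ : Real.exp (-L₂) = δ / (4 * (𝒳.card * Fintype.card A)) := by
    rw [hL₂, Real.exp_neg, Real.exp_log (by positivity), inv_div, mul_assoc]
  set t₁ : ℝ := √(2 * L₁ / n) + √((𝒳.card : ℝ) / n) with ht₁
  set t₂ : ℝ := √(4 * L₂ / (n * r)) + √(2 * Ξ.card / (n * r)) with ht₂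
  have ht₁0 : 0 ≤ t₁ := by positivity
  have ht₂0 : 0 ≤ t₂ := by positivity
  have hm0 : 0 < n * r / 2 := by positivity
  let E₁ : Set Ω := {ω | ∃ U, ω ∈ {ω | t₁ ≤
    ∑ x ∈ U, empContext (fun i => D i ω) x - ∑ x ∈ U, P₀ x}}
  let E₂ : 𝒳 × A → Set Ω := fun p => {ω | pairCount (fun i => D i ω) p.1 p.2 < n * r / 2}
  let E₃ : 𝒳 × A → Set Ω := fun p => {ω | ∃ U, ω ∈ {ω |
    n * r / 2 ≤ pairCount (fun i => D i ω) p.1 p.2 ∧ t₂ ≤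
      ∑ z ∈ U, empOutcome (fun i => D i ω) p.1 p.2 z - ∑ z ∈ U, Q₀ p.1 p.2 z}}
  have hE₁ : μ.real E₁ ≤ δ / 2 := by
    rw [← hexp₁]
    refine (measureReal_exists_finset_le fun U =>
      hD.measureReal_empContext_le hn0' hP hπ₀ hQ ht₁0 U).trans ?_
    refine two_pow_mul_exp_neg_le hL₁0 ?_
    have h := add_le_sq_sqrt_add_sqrt (a := 2 * L₁ / n) (b := 𝒳.card / n) (by positivity)
      (by positivity)
    rw [← ht₁, ← add_div, div_le_iff₀ hn0] at h
    rw [Fintype.card_coe]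
    linarith
  have hE₂ : ∀ p, μ.real (E₂ p) ≤ δ / (4 * (𝒳.card * Fintype.card A)) := by
    intro p
    rw [← hexp₂]
    have hp : r ≤ P₀ p.1 * π₀ p.1 p.2 := by
      rw [hr, mul_comm]
      exact mul_le_mul (hP' _) (hπ₀' _ _) hμπ.le (hP.1 _)
    refine (hD.measureReal_pairCount_le hP hπ₀ hQ hr0.le hp).trans (Real.exp_le_exp.2 ?_)
    -- The sample-size condition says exactly that the exponent `n * r ^ 2 / 2` is at least `L₂`.
    rw [div_le_iff₀ (by positivity)] at hn
    linarith
  have hE₃ : ∀ p, μ.real (E₃ p) ≤ δ / (4 * (𝒳.card * Fintype.card A)) := by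
    intro p
    rw [← hexp₂]
    refine (measureReal_exists_finset_le fun U =>
      hD.measureReal_empOutcome_le hP hπ₀ hQ p.1 p.2 ht₂0 hm0 U).trans ?_
    refine two_pow_mul_exp_neg_le hL₂0.le ?_
    have h := add_le_sq_sqrt_add_sqrt (a := 4 * L₂ / (n * r)) (b := 2 * Ξ.card / (n * r))
      (by positivity) (by positivity)
    rw [← ht₂, ← add_div, div_le_iff₀ (by positivity)] at h
    rw [Fintype.card_coe]
    linarith
  have hbad : μ.real (E₁ ∪ ⋃ p, (E₂ p ∪ E₃ p)) ≤ δ := by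
    refine (measureReal_union_le _ _).trans ?_
    have h : μ.real (⋃ p, (E₂ p ∪ E₃ p)) ≤ δ / 2 := by
      refine (measureReal_iUnion_fintype_le _).trans ((Finset.sum_le_sum fun p _ =>
        (measureReal_union_le _ _).trans (add_le_add (hE₂ p) (hE₃ p))).trans_eq ?_)
      rw [Finset.sum_const, Finset.card_univ, Fintype.card_prod, Fintype.card_coe, nsmul_eq_mul,
        Nat.cast_mul]
      field_simp
      ring
    linarith
  -- Covering the whole space and using subadditivity requires no measurability of the good event.
  have hcover : (Set.univ : Set Ω) ⊆ {ω | |empPolicyValue εx εc (fun i => D i ω) y π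
          - policyValue εx εc P₀ Q₀ y π|
        ≤ opeBound Ymax μπ μx δ n 𝒳.card (Fintype.card A) Ξ.card} ∪
      (E₁ ∪ ⋃ p, (E₂ p ∪ E₃ p)) := by
    intro ω _
    by_cases hω : ω ∈ E₁ ∪ ⋃ p, (E₂ p ∪ E₃ p)
    · exact Or.inr hω
    left
    simp only [Set.mem_union, Set.mem_iUnion, not_or, not_exists] at hω
    obtain ⟨h1, h23⟩ := hω
    have hN : ∀ x a, n * r / 2 ≤ pairCount (fun i => D i ω) x a := fun x a =>
      not_lt.1 (h23 (x, a)).1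
    refine (abs_empPolicyValue_sub_policyValue_le hn0' (fun i => D i ω) hP hQ hπ hy hεx hεc
      (t₁ := t₁) (t₂ := t₂) (fun U => ?_) (fun x a => (hm0.trans_le (hN x a)).ne')
      fun x a U => ?_).trans_eq ?_
    · exact (not_le.1 fun h => h1 ⟨U, h⟩).le
    · exact (not_le.1 fun h => (h23 (x, a)).2 ⟨U, hN x a, h⟩).le
    · rw [opeBound, ht₁, ht₂, add_assoc (_ + _)]
  have h := measureReal_mono (μ := μ) hcover
  rw [probReal_univ] at h
  linarith [h.trans (measureReal_union_le _ _)]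

/-! ### The explicit bound as a rate -/

/-- As `cX + cZ ≥ 1`, the numerical parts `log 2` and `log 4` of the logarithms are absorbed by the
cardinality term. -/
theorem opeBound_le_rate {Ymax μπ μx δ : ℝ} (hY : 0 ≤ Ymax) (hμπ : 0 < μπ) (hμx : 0 < μx)
    (hδ : 0 < δ) (hδ1 : δ < 1) {n cX cA cZ : ℕ} (hX : 1 ≤ cX) (hA : 1 ≤ cA) :
    opeBound Ymax μπ μx δ n cX cA cZ ≤
      Ymax * (√2 + 1 + √(8 / (μπ * μx)) + √(2 / (μπ * μx))) * √(Real.log (cX * cA / δ) / n) +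
      Ymax * (√2 + 1 + √(8 / (μπ * μx)) + √(2 / (μπ * μx))) * √(((cX : ℝ) + cZ) / n) := by
  have hX' : (1 : ℝ) ≤ cX := by exact_mod_cast hX
  have hA' : (1 : ℝ) ≤ cA := by exact_mod_cast hA
  have hXA : (1 : ℝ) ≤ cX * cA := one_le_mul_of_one_le_of_one_le hX' hA'
  have hr0 : 0 < μπ * μx := mul_pos hμπ hμx
  set r : ℝ := μπ * μx
  set L : ℝ := Real.log (cX * cA / δ) with hL
  have hL0 : 0 ≤ L := Real.log_nonneg (by rw [le_div_iff₀ hδ]; linarith)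
  have hlog2 : Real.log 2 ≤ 1 := by linarith [Real.log_two_lt_d9]
  have hS : (1 : ℝ) ≤ cX + cZ := by linarith [Nat.cast_nonneg (α := ℝ) cZ]
  have h2 : Real.log (2 / δ) ≤ L + 1 * (cX + cZ) := by
    have h : Real.log (2 / δ) ≤ Real.log (2 * (cX * cA / δ)) := by
      refine Real.log_le_log (by positivity) ?_
      rw [← mul_div_assoc]
      gcongr
      linarith
    rw [Real.log_mul (by norm_num) (by positivity)] at h
    linarith
  have h4 : Real.log (4 * cX * cA / δ) ≤ L + 2 * (cX + cZ) := by
    rw [show (4 * cX * cA / δ : ℝ) = 2 ^ 2 * (cX * cA / δ) by ring,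
      Real.log_mul (by norm_num) (by positivity), Real.log_pow]
    push_cast
    linarith
  have split : ∀ {k a b : ℝ}, 0 ≤ k → 0 ≤ a → 0 ≤ b → ∀ {w : ℝ}, w ≤ k * (a + b) →
      √w ≤ √k * √a + √k * √b := by
    intro k a b hk ha hb w hw
    rw [← mul_add]
    refine Real.sqrt_le_iff.2 ⟨by positivity, hw.trans ?_⟩
    rw [mul_pow, Real.sq_sqrt hk]
    exact mul_le_mul_of_nonneg_left (add_le_sq_sqrt_add_sqrt ha hb) hk
  have hLn : 0 ≤ L / n := by positivity
  have hSn : 0 ≤ ((cX : ℝ) + cZ) / n := by positivity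
  have b1 : √(2 * Real.log (2 / δ) / n) ≤ √2 * √(L / n) + √2 * √(((cX : ℝ) + cZ) / n) := by
    refine split zero_le_two hLn hSn ?_
    rw [← add_div, ← mul_div_assoc]
    gcongr
    linarith
  have b2 : √((cX : ℝ) / n) ≤ √(((cX : ℝ) + cZ) / n) := by
    gcongr
    linarith [Nat.cast_nonneg (α := ℝ) cZ]
  have b3 : √(4 * Real.log (4 * cX * cA / δ) / (n * r)) ≤
      √(8 / r) * √(L / n) + √(8 / r) * √(((cX : ℝ) + cZ) / n) := by
    refine split (by positivity) hLn hSn ?_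
    rw [← add_div, div_mul_div_comm, mul_comm (n : ℝ) r]
    refine div_le_div_of_nonneg_right ?_ (by positivity)
    linarith
  have b4 : √(2 * (cZ : ℝ) / (n * r)) ≤ √(2 / r) * √(((cX : ℝ) + cZ) / n) := by
    rw [← Real.sqrt_mul (by positivity), div_mul_div_comm, mul_comm (n : ℝ) r]
    gcongr
    linarith
  rw [opeBound, mul_assoc Ymax, mul_assoc Ymax, ← mul_add]
  refine mul_le_mul_of_nonneg_left ?_ hY
  have p1 : 0 ≤ √(L / n) := Real.sqrt_nonneg _
  have p2 : 0 ≤ √(2 / r) * √(L / n) := by positivity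
  linarith

theorem mainTheorem1 (Ymax μπ μx : ℝ) (hμπ : 0 < μπ) (hμx : 0 < μx) :
    -- the constant in the rate depends on `Ymax`, `μπ`, `μx` only
    ∃ C : ℝ, 0 ≤ C ∧
      ∀ (d e : ℕ) (𝒳 : Finset (EuclideanSpace ℝ (Fin d))) (Ξ : Finset (EuclideanSpace ℝ (Fin e)))
        (A : Type*) [Fintype A] [MeasurableSpace A] [MeasurableSingletonClass A]
        (P₀ : 𝒳 → ℝ) (π₀ : 𝒳 → A → ℝ) (Q₀ : 𝒳 → A → Ξ → ℝ) (y : 𝒳 → A → Ξ → ℝ)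
        (π : 𝒳 → A → ℝ) (εx εc δ : ℝ) (n : ℕ)
        (Ω : Type*) [MeasurableSpace Ω] (μ : Measure Ω) [IsProbabilityMeasure μ]
        (D : Fin n → Ω → 𝒳 × A × Ξ),
        P₀ ∈ stdSimplex ℝ 𝒳 →
        (∀ x, π₀ x ∈ stdSimplex ℝ A) →
        (∀ x a, Q₀ x a ∈ stdSimplex ℝ Ξ) →
        (∀ x, π x ∈ stdSimplex ℝ A) →
        (∀ x a, μπ ≤ π₀ x a) →
        (∀ x, μx ≤ P₀ x) →
        (∀ x a ξ, 0 ≤ y x a ξ ∧ y x a ξ ≤ Ymax) →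
        0 < εx → 0 < εc → 0 < δ → δ < 1 →
        IsLoggedData P₀ π₀ Q₀ μ D →
        2 * Real.log (4 * 𝒳.card * Fintype.card A / δ) / (μπ * μx) ^ 2 ≤ n →
        1 - δ ≤ μ.real {ω | |empPolicyValue εx εc (fun i => D i ω) y π
              - policyValue εx εc P₀ Q₀ y π|
            ≤ opeBound Ymax μπ μx δ n 𝒳.card (Fintype.card A) Ξ.card} ∧
        opeBound Ymax μπ μx δ n 𝒳.card (Fintype.card A) Ξ.card
          ≤ C * √(Real.log (𝒳.card * Fintype.card A / δ) / n)
            + C * √(((𝒳.card : ℝ) + Ξ.card) / n) := by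
  -- The constant is chosen before any cost function is available to show `0 ≤ Ymax`, hence the
  -- absolute value.
  refine ⟨|Ymax| * (√2 + 1 + √(8 / (μπ * μx)) + √(2 / (μπ * μx))), by positivity, ?_⟩
  intro d e 𝒳 Ξ A _ _ _ P₀ π₀ Q₀ y π εx εc δ n Ω _ μ _ D hP hπ₀ hQ hπ hπ₀' hP' hy hεx hεc hδ hδ1
    hD hn
  refine ⟨measureReal_abs_sub_policyValue_ge hμπ hμx hP hπ₀ hQ hπ hπ₀' hP' hy hεx hεc hδ hδ1 hD hn,
    ?_⟩
  obtain ⟨x⟩ := nonempty_of_mem_stdSimplex hP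
  obtain ⟨a⟩ := nonempty_of_mem_stdSimplex (hπ x)
  obtain ⟨ξ⟩ := nonempty_of_mem_stdSimplex (hQ x a)
  have hY : 0 ≤ Ymax := (hy x a ξ).1.trans (hy x a ξ).2
  rw [abs_of_nonneg hY]
  exact opeBound_le_rate hY hμπ hμx hδ hδ1 (Finset.card_pos.2 ⟨x.1, x.2⟩)
    (Fintype.card_pos_iff.2 ⟨a⟩)
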